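/- Let $\mathcal H$ be a separable complex Hilbert space of infinite dimension, and let $\mathcal R_1^+(\mathcal H)$ be the set of finite rank operators $A$ on $\mathcal H$ with $0\le A\le I$, directed by the usual order of operators. For $1\le p\le\infty$ (with $1/\infty=0$) and a compact operator $T$ put $$|T|_p^-=\sum_{j\ge 1}s_j(T)\,j^{-1+1/p}\in[0,\infty],$$ where $s_1(T)\ge s_2(T)\ge\cdots$ are the eigenvalues of $|T|=(T^*T)^{1/2}$ in decreasing order, repeated according to multiplicity and followed by zeros if there are only finitely many non-zero ones. For an $n$-tuple $\sigma=(S_1,\dots,S_n)$ of compact operators put $$|\sigma|_p^{\sim}=\bigl|(S_1^*S_1+\cdots+S_n^*S_n)^{1/2}\bigr|_p^-.$$ For an $n$-tuple $\tau=(T_1,\dots,T_n)$ of bounded operators on $\mathcal H$ write $[\tau,A]=(T_iA-AT_i)_{1\le i\le n}$ and define the rotation-invariant quasicentral modulus $$\tilde k_p^-(\tau)=\liminf_{A\in\mathcal R_1^+(\mathcal H)}\bigl|[\tau,A]\bigr|_p^{\sim}\in[0,\infty],$$ the lower limit being taken along the directed set $\mathcal R_1^+(\mathcal H)$. Let $\tau\otimes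 I_m=(T_i\otimes I_m)_{1\le i\le n}$ be the $m$-fold ampliation of $\tau$, acting on $\mathcal H\otimes\mathbb C^m\cong\mathcal H\oplus\cdots\oplus\mathcal H$ ($m$ summands) by $T_i\otimes I_m=T_i\oplus\cdots\oplus T_i$. **Theorem.** For every $n$-tuple $\tau$ of bounded operators on $\mathcal H$, every integer $m\ge 1$ and every $1\le p\le\infty$, $$\tilde k_p^-(\tau\otimes I_m)=m^{1/p}\,\tilde k_p^-(\tau).$$ -/

import Mathlib

open scoped ENNReal

namespace QuasicentralModulus

noncomputable section

/-- The `j`-th singular number (`j = 0, 1, 2, …`) of a compact operator `T`: the `(j+1)`-st entry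
of the list of the eigenvalues of `|T| = (T*T)^{1/2}` in decreasing order, repeated according to
multiplicity and followed by zeros if the list is finite. It is the largest `t > 0` such that `|T|`
has at least `j + 1` eigenvalues, counted with multiplicity, in `[t, ∞)`, and `0` if there is no
such `t`. -/
def singularNumber {H : Type*} [NormedAddCommGroup H] [InnerProductSpace ℂ H] [CompleteSpace H]
    (T : H →L[ℂ] H) (j : ℕ) : ℝ :=
  sSup {t : ℝ | 0 < t ∧ ((j + 1 : ℕ) : Cardinal) ≤ Module.rank ℂ
    ↥(⨆ (μ : ℝ) (_ : t ≤ μ), Module.End.eigenspace (CFC.abs T : H →L[ℂ] H).toLinearMap (μ : ℂ))}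

/-- The norm `|T|_p^- = ∑_{j ≥ 1} s_j j^{-1 + 1/p}` of the `(p,1)` Lorentz ideal, for a compact
operator `T`, with values in `[0, ∞]`; here `1/p = 0` for `p = ∞`. -/
def lorentzNorm {H : Type*} [NormedAddCommGroup H] [InnerProductSpace ℂ H] [CompleteSpace H]
    (p : ℝ≥0∞) (T : H →L[ℂ] H) : ℝ≥0∞ :=
  ∑' j : ℕ, ENNReal.ofReal (singularNumber T j * ((j : ℝ) + 1) ^ (-1 + p⁻¹.toReal))

/-- The rotation-invariant norm of an `n`-tuple: the `(p,1)` Lorentz norm of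
`(T₁*T₁ + ⋯ + Tₙ*Tₙ)^{1/2}`. -/
def tupleLorentzNorm {H : Type*} [NormedAddCommGroup H] [InnerProductSpace ℂ H] [CompleteSpace H]
    (p : ℝ≥0∞) {n : ℕ} (τ : Fin n → (H →L[ℂ] H)) : ℝ≥0∞ :=
  lorentzNorm p (CFC.sqrt (∑ i, star (τ i) * τ i))

/-- The positive contractions of finite rank, `0 ≤ A ≤ I`, with the usual (Loewner) order of
operators. -/
def finiteRankContractions (H : Type*) [NormedAddCommGroup H] [InnerProductSpace ℂ H]
    [CompleteSpace H] : Set (H →L[ℂ] H) :=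
  {A | 0 ≤ A ∧ A ≤ 1 ∧ FiniteDimensional ℂ A.toLinearMap.range}

/-- The commutator `[τ, A] = (T_i A - A T_i)_i` of an `n`-tuple with an operator. -/
def tupleCommutator {H : Type*} [NormedAddCommGroup H] [InnerProductSpace ℂ H]
    {n : ℕ} (τ : Fin n → (H →L[ℂ] H)) (A : H →L[ℂ] H) : Fin n → (H →L[ℂ] H) :=
  fun i => τ i * A - A * τ i

/-- The rotation-invariant quasicentral modulus of an `n`-tuple with respect to the `(p,1)` Lorentz
ideal: the lower limit of the norms of `[τ, A]` along the directed set of the positive contractions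
of finite rank. -/
def quasicentralModulus {H : Type*} [NormedAddCommGroup H] [InnerProductSpace ℂ H]
    [CompleteSpace H] (p : ℝ≥0∞) {n : ℕ} (τ : Fin n → (H →L[ℂ] H)) : ℝ≥0∞ :=
  Filter.liminf
    (fun A : finiteRankContractions H => tupleLorentzNorm p (tupleCommutator τ (A : H →L[ℂ] H)))
    Filter.atTop

/-- The ampliation `T ⊗ I_m` on `H ⊗ ℂ^m`, identified with the Hilbert space direct sum
`H ⊕ ⋯ ⊕ H` of `m` copies of `H`: it is `T ⊕ ⋯ ⊕ T`. -/
def ampliation {H : Type*} [NormedAddCommGroup H] [InnerProductSpace ℂ H] (m : ℕ)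
    (T : H →L[ℂ] H) : PiLp 2 (fun _ : Fin m => H) →L[ℂ] PiLp 2 (fun _ : Fin m => H) :=
  (PiLp.continuousLinearEquiv 2 ℂ (fun _ : Fin m => H)).symm.toContinuousLinearMap ∘L
    (ContinuousLinearMap.piMap fun _ : Fin m => T) ∘L
      (PiLp.continuousLinearEquiv 2 ℂ (fun _ : Fin m => H)).toContinuousLinearMap

end

end QuasicentralModulus

/-! A tuple is studied through its column operator `x ↦ (S_i x)_i`, whose modulus is `(∑ S_i*
S_i)^{1/2}`. For finite rank, a singular value decomposition turns the Lorentz norm into `∑ w_j l_j`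
with decreasing weights `w_j`. The trace inequality `IsSVD.sum_re_inner_le` bounds this sum below by
testing against any two orthonormal systems.

Lower bound: for a contraction `B` on `H ⊕ ⋯ ⊕ H`, let `A` be the mean of its diagonal blocks. Test
the commutator of the ampliation with `B` on the `m` copies of the singular vectors of `[τ, A]`. The
`m` diagonal coefficients add up to `m l_j`, and the weights at positions `a + m j`, `a < m`, are at
least `m^{-1+1/p} w_j`, so the norm is at least `m^{1/p}` times that of `[τ, A]`. Averaging is
monotone and inverts ampliation, so the bound passes to lower limits.

Upper bound: ampliations `A ⊗ I` are cofinal, and ampliating repeats each singular value of `[τ, A]`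
`m` times. The weights of the `j`-th block sum to about `m^{1/p} w_j` for large `j`; the finitely
many remaining blocks are controlled by the operator norm. That norm can be made small
(`exists_commutator_small`): for `A₂` far beyond `A₁` the columns of the two commutators have
orthogonal ranges, so the midpoint halves the squared norm bound, while convexity keeps the Lorentz
bound. -/

namespace QuasicentralModulus

open scoped InnerProductSpace

section SingularValueDecomposition

/-! ### Rearrangement inequalities -/

/-- Against decreasing weights, a vector with entries in `[0, 1]` and total mass at most `t` is
dominated by the indicator of the first `t` positions. -/
theorem sum_antitone_mul_le {w : ℕ → ℝ} (hw : Antitone w) (hw0 : ∀ j, 0 ≤ w j) (t : ℕ) {k : ℕ}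
    (d : Fin k → ℝ) (hd0 : ∀ j, 0 ≤ d j) (hd1 : ∀ j, d j ≤ 1) (hd : ∑ j, d j ≤ t) :
    ∑ j : Fin k, w j * d j ≤ ∑ i : Fin t, w i := by
  -- After subtracting `w t` the weights are nonnegative before position `t` and nonpositive from it
  -- on, so the indicator is the best choice of `d`. The subtracted part is paid for by `∑ d ≤ t`.
  have h1 : ∑ j : Fin k, (w j - w t) * d j ≤ ∑ i : Fin t, (w i - w t) := by
    calc ∑ j : Fin k, (w j - w t) * d j
        ≤ ∑ j : Fin k, (if (j : ℕ) < t then w j - w t else 0) := by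
          refine Finset.sum_le_sum fun j _ => ?_
          split_ifs with h
          · have := hw h.le
            nlinarith [hd1 j]
          · have := hw (not_lt.1 h)
            nlinarith [hd0 j]
      _ = ∑ j ∈ Finset.range k, (if j < t then w j - w t else 0) :=
          Fin.sum_univ_eq_sum_range (fun j => if j < t then w j - w t else 0) k
      _ = ∑ j ∈ (Finset.range k).filter (· < t), (w j - w t) := by rw [Finset.sum_filter]
      _ ≤ ∑ j ∈ Finset.range t, (w j - w t) := by
          refine Finset.sum_le_sum_of_subset_of_nonneg (fun j hj => ?_) fun j hj _ => ?_
          · exact Finset.mem_range.2 (Finset.mem_filter.1 hj).2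
          · exact sub_nonneg.2 (hw (Finset.mem_range.1 hj).le)
      _ = ∑ i : Fin t, (w i - w t) := (Fin.sum_univ_eq_sum_range (fun j => w j - w t) t).symm
  have h2 : ∑ j : Fin k, w j * d j = ∑ j : Fin k, (w j - w t) * d j + w t * ∑ j, d j := by
    rw [Finset.mul_sum, ← Finset.sum_add_distrib]
    exact Finset.sum_congr rfl fun j _ => by ring
  have h3 : ∑ i : Fin t, (w i - w t) = ∑ i : Fin t, w i - t * w t := by
    simp [Finset.sum_sub_distrib]
  nlinarith [mul_le_mul_of_nonneg_left hd (hw0 t)]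

/-- Abel summation: nonnegative partial sums give a nonnegative sum against decreasing weights. -/
theorem le_sum_mul_of_partialSums_nonneg {l : ℕ → ℝ} (hl : Antitone l) :
    ∀ {r : ℕ} (a : Fin r → ℝ),
      (∀ t (h : t ≤ r), 0 ≤ ∑ i : Fin t, a (Fin.castLE h i)) →
      l r * ∑ i, a i ≤ ∑ i : Fin r, l i * a i
  | 0, a, _ => by simp
  | r + 1, a, ha => by
      -- The bound `l r * ∑ a`, stronger than `0`, carries the induction: the new term comes with
      -- the factor `l r`, and lowering this to `l (r + 1)` is harmless since the total is
      -- nonnegative.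
      have ih := le_sum_mul_of_partialSums_nonneg hl (fun i : Fin r => a i.castSucc)
        fun t h => ha t (h.trans r.le_succ)
      have h1 : 0 ≤ ∑ i, a i := ha (r + 1) le_rfl
      have h2 : l (r + 1) * ∑ i, a i ≤ l r * ∑ i, a i :=
        mul_le_mul_of_nonneg_right (hl r.le_succ) h1
      refine h2.trans ?_
      rw [Fin.sum_univ_castSucc, Fin.sum_univ_castSucc, mul_add]
      simpa using ih

/-! ### Singular value decompositions of operators of finite rank -/

variable {H K : Type*} [NormedAddCommGroup H] [InnerProductSpace ℂ H]
  [NormedAddCommGroup K] [InnerProductSpace ℂ K]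

/-- `C = ∑_{i < r} l_i ⟨e_i, ·⟩ u_i` is a singular value decomposition with `r` non-zero singular
values. -/
structure IsSVD {r : ℕ} (C : H →L[ℂ] K) (l : ℕ → ℝ) (e : Fin r → H) (u : Fin r → K) : Prop where
  antitone : Antitone l
  pos : ∀ i < r, 0 < l i
  eq_zero : ∀ i, r ≤ i → l i = 0
  left : Orthonormal ℂ e
  right : Orthonormal ℂ u
  apply : ∀ x, C x = ∑ i : Fin r, ((l i : ℂ) * ⟪e i, x⟫_ℂ) • u i

namespace IsSVD

variable {r : ℕ} {C : H →L[ℂ] K} {l : ℕ → ℝ} {e : Fin r → H} {u : Fin r → K}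

theorem nonneg (h : IsSVD C l e u) (i : ℕ) : 0 ≤ l i := by
  rcases lt_or_ge i r with hi | hi
  · exact (h.pos i hi).le
  · exact (h.eq_zero i hi).ge

theorem apply_left (h : IsSVD C l e u) (i : Fin r) : C (e i) = (l i : ℂ) • u i := by
  rw [h.apply, Finset.sum_eq_single i]
  · simp [h.left.1 i]
  · intro j _ hj
    simp [h.left.2 hj]
  · simp

theorem inner_apply_left (h : IsSVD C l e u) (i : Fin r) : ⟪u i, C (e i)⟫_ℂ = l i := by
  rw [h.apply_left, inner_smul_right, inner_self_eq_norm_sq_to_K, h.right.1 i]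
  simp

theorem norm_apply_left (h : IsSVD C l e u) (i : Fin r) : ‖C (e i)‖ = l i := by
  rw [h.apply_left, norm_smul, h.right.1 i, mul_one, Complex.norm_real, Real.norm_eq_abs,
    abs_of_nonneg (h.nonneg i)]

/-- A trace inequality: decreasing weights tested against orthonormal systems. -/
theorem sum_re_inner_le (h : IsSVD C l e u) {w : ℕ → ℝ} (hw : Antitone w) (hw0 : ∀ j, 0 ≤ w j)
    {k : ℕ} {v : Fin k → ℝ} (hv0 : ∀ j, 0 ≤ v j) (hv : ∀ j : Fin k, v j ≤ w j)
    {x : Fin k → H} (hx : Orthonormal ℂ x) {f : Fin k → K} (hf : Orthonormal ℂ f) :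
    ∑ j, v j * (⟪f j, C (x j)⟫_ℂ).re ≤ ∑ i : Fin r, w i * l i := by
  -- `M` comes from `st ≤ (s² + t²)/2` applied to the two overlaps; by Bessel it is doubly
  -- substochastic.
  set M : Fin r → Fin k → ℝ := fun i j => (‖⟪e i, x j⟫_ℂ‖ ^ 2 + ‖⟪u i, f j⟫_ℂ‖ ^ 2) / 2 with hM
  have hM0 : ∀ i j, 0 ≤ M i j := fun i j => by positivity
  have hrow : ∀ i, ∑ j, M i j ≤ 1 := by
    intro i
    have h1 := hx.sum_inner_products_le (e i) (s := Finset.univ)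
    have h2 := hf.sum_inner_products_le (u i) (s := Finset.univ)
    rw [h.left.1] at h1
    rw [h.right.1] at h2
    simp only [hM, ← Finset.sum_div, Finset.sum_add_distrib]
    simp_rw [norm_inner_symm (e i), norm_inner_symm (u i)]
    linarith
  have hcol : ∀ j t (ht : t ≤ r), ∑ i : Fin t, M (Fin.castLE ht i) j ≤ 1 := by
    intro j t ht
    have h1 := (h.left.comp _ (Fin.castLE_injective ht)).sum_inner_products_le (x j)
      (s := Finset.univ)
    have h2 := (h.right.comp _ (Fin.castLE_injective ht)).sum_inner_products_le (f j)
      (s := Finset.univ)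
    rw [hx.1] at h1
    rw [hf.1] at h2
    simp only [hM, ← Finset.sum_div, Finset.sum_add_distrib]
    simp only [Function.comp] at h1 h2
    linarith
  have hterm : ∀ j, v j * (⟪f j, C (x j)⟫_ℂ).re ≤ ∑ i : Fin r, l i * (w j * M i j) := by
    intro j
    have h1 : (⟪f j, C (x j)⟫_ℂ).re ≤ ∑ i : Fin r, l i * M i j := by
      rw [h.apply, inner_sum, Complex.re_sum]
      refine Finset.sum_le_sum fun i _ => ?_
      refine (Complex.re_le_norm _).trans ?_
      rw [inner_smul_right, norm_mul, norm_mul, Complex.norm_real, Real.norm_eq_abs,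
        abs_of_nonneg (h.nonneg i), norm_inner_symm (f j), mul_assoc]
      refine mul_le_mul_of_nonneg_left ?_ (h.nonneg i)
      simp only [hM]
      nlinarith [sq_nonneg (‖⟪e i, x j⟫_ℂ‖ - ‖⟪u i, f j⟫_ℂ‖)]
    have h0 : 0 ≤ ∑ i : Fin r, l i * M i j :=
      Finset.sum_nonneg fun i _ => mul_nonneg (h.nonneg i) (hM0 i j)
    calc v j * (⟪f j, C (x j)⟫_ℂ).re ≤ v j * ∑ i : Fin r, l i * M i j :=
          mul_le_mul_of_nonneg_left h1 (hv0 j)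
      _ ≤ w j * ∑ i : Fin r, l i * M i j := mul_le_mul_of_nonneg_right (hv j) h0
      _ = _ := by
          rw [Finset.mul_sum]
          exact Finset.sum_congr rfl fun i _ => by ring
  have hpart : ∀ t (ht : t ≤ r),
      0 ≤ ∑ i : Fin t, (w i - ∑ j : Fin k, w j * M (Fin.castLE ht i) j) := by
    intro t ht
    rw [Finset.sum_sub_distrib, Finset.sum_comm, sub_nonneg]
    simp_rw [← Finset.mul_sum]
    refine sum_antitone_mul_le hw hw0 t _ (fun j => Finset.sum_nonneg fun i _ => hM0 _ _)
      (fun j => hcol j t ht) ?_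
    rw [Finset.sum_comm]
    calc ∑ i : Fin t, ∑ j, M (Fin.castLE ht i) j ≤ ∑ _i : Fin t, (1 : ℝ) :=
          Finset.sum_le_sum fun i _ => hrow _
      _ = t := by simp
  have habel := le_sum_mul_of_partialSums_nonneg h.antitone
    (fun i : Fin r => w i - ∑ j : Fin k, w j * M i j) hpart
  -- The boundary term of the Abel summation vanishes because `l r = 0`.
  rw [h.eq_zero r le_rfl, zero_mul] at habel
  calc ∑ j, v j * (⟪f j, C (x j)⟫_ℂ).re ≤ ∑ j : Fin k, ∑ i : Fin r, l i * (w j * M i j) :=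
        Finset.sum_le_sum fun j _ => hterm j
    _ = ∑ i : Fin r, l i * ∑ j : Fin k, w j * M i j := by
        rw [Finset.sum_comm]
        simp_rw [Finset.mul_sum]
    _ ≤ ∑ i : Fin r, w i * l i := by
        simp_rw [mul_sub, Finset.sum_sub_distrib] at habel
        simp_rw [mul_comm (w _) (l _)]
        linarith

end IsSVD

/-- Every operator of finite rank has a singular value decomposition. -/
theorem exists_isSVD [CompleteSpace H] [CompleteSpace K] (C : H →L[ℂ] K)
    (hC : FiniteDimensional ℂ C.toLinearMap.range) :
    ∃ (r : ℕ) (l : ℕ → ℝ) (e : Fin r → H) (u : Fin r → K), IsSVD C l e u := by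
  set G : H →L[ℂ] H := C.adjoint ∘L C with hG
  have hGi : ∀ x y, ⟪x, G y⟫_ℂ = ⟪C x, C y⟫_ℂ := fun x y => by
    simp [hG, ContinuousLinearMap.adjoint_inner_right]
  have hsym : G.toLinearMap.IsSymmetric := fun x y => by
    have h1 := hGi y x
    have h2 := hGi x y
    change ⟪G x, y⟫_ℂ = ⟪x, G y⟫_ℂ
    rw [h2, ← inner_conj_symm, h1, inner_conj_symm]
  set V : Submodule ℂ H := G.toLinearMap.range with hV
  have hVfin : FiniteDimensional ℂ V := by
    have : V = C.toLinearMap.range.map C.adjoint.toLinearMap := by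
      rw [hV, hG, ← LinearMap.range_comp]
      rfl
    rw [this]
    infer_instance
  have hinv : ∀ x ∈ V, G.toLinearMap x ∈ V := fun x _ => ⟨x, rfl⟩
  set S : V →ₗ[ℂ] V := G.toLinearMap.restrict hinv with hS
  have hSsym : S.IsSymmetric := hsym.restrict_invariant hinv
  set r := Module.finrank ℂ V with hr
  set b := hSsym.eigenvectorBasis hr.symm with hb
  set ν := hSsym.eigenvalues hr.symm with hν
  set e : Fin r → H := fun i => (b i : H) with he
  have heo : Orthonormal ℂ e := b.orthonormal.comp_linearIsometry V.subtypeₗᵢ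
  have heig : ∀ i, G (e i) = (ν i : ℂ) • e i := fun i => by
    have := congrArg Subtype.val (hSsym.apply_eigenvectorBasis hr.symm i)
    exact this
  have hCe : ∀ i j, ⟪C (e i), C (e j)⟫_ℂ = if i = j then (ν j : ℂ) else 0 := fun i j => by
    rw [← hGi, heig, inner_smul_right, orthonormal_iff_ite.1 heo]
    split_ifs <;> simp
  have hnorm : ∀ i, ν i = ‖C (e i)‖ ^ 2 := fun i => by
    have h1 := hCe i i
    rw [inner_self_eq_norm_sq_to_K, if_pos rfl] at h1
    refine Complex.ofReal_injective (h1.symm.trans ?_)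
    push_cast
    rfl
  -- Diagonalising `C*C` only on its range `V` excludes the eigenvalue zero: if `C e_i = 0`, then
  -- `e_i = G y` is orthogonal to itself.
  have hνpos : ∀ i, 0 < ν i := fun i => by
    rw [hnorm]
    refine pow_pos (norm_pos_iff.2 fun h0 => ?_) 2
    obtain ⟨y, hy⟩ := (b i).2
    have h1 : ⟪e i, e i⟫_ℂ = 0 := by
      have : e i = G y := hy.symm
      nth_rewrite 2 [this]
      rw [hGi, h0, inner_zero_left]
    exact heo.ne_zero i (inner_self_eq_zero.1 h1)
  have hνanti : Antitone ν := hSsym.eigenvalues_antitone hr.symm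
  set l : ℕ → ℝ := fun i => if h : i < r then Real.sqrt (ν ⟨i, h⟩) else 0 with hl
  have hlν : ∀ i : Fin r, l i = Real.sqrt (ν i) := fun i => by simp [hl]
  have hlpos : ∀ i < r, 0 < l i := fun i hi => by
    simp only [hl, dif_pos hi]
    exact Real.sqrt_pos.2 (hνpos _)
  have hlz : ∀ i, r ≤ i → l i = 0 := fun i hi => by
    simp only [hl, dif_neg (not_lt.2 hi)]
  have hlsq : ∀ i : Fin r, (l i : ℂ) * l i = ν i := fun i => by
    rw [hlν]
    exact_mod_cast Real.mul_self_sqrt (hνpos i).le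
  have hl0 : ∀ i : Fin r, (l i : ℂ) ≠ 0 := fun i => by
    exact_mod_cast (hlpos i i.2).ne'
  refine ⟨r, l, e, fun i => ((l i : ℂ)⁻¹) • C (e i), ?_, hlpos, hlz, heo, ?_, ?_⟩
  · intro i j hij
    rcases lt_or_ge j r with hj | hj
    · simp only [hl, dif_pos hj, dif_pos (hij.trans_lt hj)]
      exact Real.sqrt_le_sqrt (hνanti hij)
    · rw [hlz j hj]
      rcases lt_or_ge i r with hi | hi
      · exact (hlpos i hi).le
      · exact (hlz i hi).ge
  · rw [orthonormal_iff_ite]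
    intro i j
    rw [inner_smul_left, inner_smul_right, hCe]
    split_ifs with hij
    · subst hij
      rw [← hlsq, map_inv₀, Complex.conj_ofReal]
      field_simp [hl0 i]
    · simp
  · intro x
    -- `x'` is orthogonal to the range of `C*C`, so `‖C x'‖² = ⟪x', C*C x'⟫ = 0`.
    set x' := x - ∑ i, ⟪e i, x⟫_ℂ • e i with hx'
    have horth : ∀ i, ⟪e i, x'⟫_ℂ = 0 := fun i => by
      rw [hx', inner_sub_right, heo.inner_right_fintype, sub_self]
    have hGx' : ⟪x', G x'⟫_ℂ = 0 := by
      have h1 : G x' = ∑ i, b.repr ⟨G x', x', rfl⟩ i • e i := by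
        have := congrArg Subtype.val (b.sum_repr ⟨G x', x', rfl⟩)
        simp only [Submodule.coe_sum, Submodule.coe_smul] at this
        exact this.symm
      rw [h1, inner_sum]
      refine Finset.sum_eq_zero fun i _ => ?_
      rw [inner_smul_right, ← inner_conj_symm, horth, map_zero, mul_zero]
    have hCx' : C x' = 0 := by
      rw [hGi] at hGx'
      exact inner_self_eq_zero.1 hGx'
    have hx : x = x' + ∑ i, ⟪e i, x⟫_ℂ • e i := by rw [hx', sub_add_cancel]
    conv_lhs => rw [hx, map_add, hCx', zero_add, map_sum]
    refine Finset.sum_congr rfl fun i _ => ?_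
    rw [map_smul, smul_smul, mul_right_comm, mul_inv_cancel₀ (hl0 i), one_mul]

end SingularValueDecomposition

section LorentzNorm

/-! ### Singular numbers and Lorentz norms of tuples -/

variable {H : Type*} [NormedAddCommGroup H] [InnerProductSpace ℂ H]

/-- The column operator `x ↦ (S_1 x, …, S_n x)` of a tuple. -/
noncomputable def column {n : ℕ} (σ : Fin n → (H →L[ℂ] H)) : H →L[ℂ] PiLp 2 (fun _ : Fin n => H) :=
  (PiLp.continuousLinearEquiv 2 ℂ (fun _ : Fin n => H)).symm.toContinuousLinearMap ∘L
    ContinuousLinearMap.pi σ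

@[simp]
theorem column_apply {n : ℕ} (σ : Fin n → (H →L[ℂ] H)) (x : H) (i : Fin n) :
    column σ x i = σ i x := rfl

theorem inner_column {n : ℕ} (σ₁ σ₂ : Fin n → (H →L[ℂ] H)) (x y : H) :
    ⟪column σ₁ x, column σ₂ y⟫_ℂ = ∑ i, ⟪σ₁ i x, σ₂ i y⟫_ℂ := by
  simp [PiLp.inner_apply]

theorem finiteDimensional_range_column {n : ℕ} {σ : Fin n → (H →L[ℂ] H)}
    (hσ : ∀ i, FiniteDimensional ℂ (σ i).toLinearMap.range) :
    FiniteDimensional ℂ (column σ).toLinearMap.range := by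
  have hle : (column σ).toLinearMap.range ≤
      (Submodule.pi Set.univ fun i => (σ i).toLinearMap.range).map
        (WithLp.linearEquiv 2 ℂ (Fin n → H)).symm.toLinearMap := by
    rintro _ ⟨x, rfl⟩
    exact ⟨fun i => σ i x, fun i _ => ⟨x, rfl⟩, rfl⟩
  have hpi : FiniteDimensional ℂ
      (Submodule.pi Set.univ fun i => (σ i).toLinearMap.range : Submodule ℂ (Fin n → H)) := by
    let φ : (Submodule.pi Set.univ fun i => (σ i).toLinearMap.range : Submodule ℂ (Fin n → H))
        →ₗ[ℂ] (∀ i, (σ i).toLinearMap.range) :=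
      { toFun := fun v i => ⟨v.1 i, v.2 i trivial⟩
        map_add' := fun _ _ => rfl
        map_smul' := fun _ _ => rfl }
    refine FiniteDimensional.of_injective φ fun v w hvw => Subtype.ext (funext fun i => ?_)
    exact congrArg Subtype.val (congrFun hvw i)
  exact Submodule.finiteDimensional_of_le hle

/-! ### Diagonal operators and their singular numbers -/

section Diagonal

variable {r : ℕ} {l : ℕ → ℝ} {e : Fin r → H}

/-- The diagonal operator `∑_i l_i ⟨e_i, ·⟩ e_i`. -/
noncomputable def diagonalOp (l : ℕ → ℝ) (e : Fin r → H) : H →L[ℂ] H :=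
  ∑ i : Fin r, (l i : ℂ) • (innerSL ℂ (e i)).smulRight (e i)

theorem diagonalOp_apply (x : H) :
    diagonalOp l e x = ∑ i : Fin r, ((l i : ℂ) * ⟪e i, x⟫_ℂ) • e i := by
  simp [diagonalOp, mul_smul]

theorem diagonalOp_nonneg (hl : ∀ i, 0 ≤ l i) : 0 ≤ diagonalOp l e := by
  rw [ContinuousLinearMap.nonneg_iff_isPositive, ContinuousLinearMap.isPositive_iff_complex]
  intro x
  have h : ⟪diagonalOp l e x, x⟫_ℂ = ((∑ i : Fin r, l i * ‖⟪e i, x⟫_ℂ‖ ^ 2 : ℝ) : ℂ) := by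
    rw [diagonalOp_apply, sum_inner]
    push_cast
    refine Finset.sum_congr rfl fun i _ => ?_
    rw [inner_smul_left, map_mul, Complex.conj_ofReal, mul_assoc, ← Complex.conj_mul']
  rw [h]
  refine ⟨rfl, ?_⟩
  change 0 ≤ ∑ i : Fin r, l i * ‖⟪e i, x⟫_ℂ‖ ^ 2
  exact Finset.sum_nonneg fun i _ => mul_nonneg (hl i) (by positivity)

theorem inner_diagonalOp (he : Orthonormal ℂ e) (j : Fin r) (x : H) :
    ⟪e j, diagonalOp l e x⟫_ℂ = l j * ⟪e j, x⟫_ℂ := by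
  rw [diagonalOp_apply, he.inner_right_fintype]

/-- An eigenvector for `μ` has nonzero coefficients only where `l j = μ`. Since `μ ≥ t > 0`, it lies
in the range and is recovered from those coefficients; the kernel never enters. -/
theorem iSup_eigenspace_diagonalOp (he : Orthonormal ℂ e) {t : ℝ} (ht : 0 < t) :
    (⨆ (μ : ℝ) (_ : t ≤ μ), Module.End.eigenspace (diagonalOp l e).toLinearMap (μ : ℂ)) =
      Submodule.span ℂ (Set.range fun i : {i : Fin r // t ≤ l i} => e i) := by
  apply le_antisymm
  · refine iSup₂_le fun μ hμ x hx => ?_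
    have hx' : diagonalOp l e x = (μ : ℂ) • x := Module.End.mem_eigenspace_iff.1 hx
    have hμ0 : (μ : ℂ) ≠ 0 := by exact_mod_cast (ht.trans_le hμ).ne'
    have hcoef : ∀ j : Fin r, ⟪e j, x⟫_ℂ ≠ 0 → t ≤ l j := fun j hj => by
      have h1 := inner_diagonalOp (l := l) he j x
      rw [hx', inner_smul_right] at h1
      have h2 : μ = l j := by exact_mod_cast mul_right_cancel₀ hj h1
      exact h2 ▸ hμ
    have hxe : x = ∑ j : Fin r, ((μ : ℂ)⁻¹ * ((l j : ℂ) * ⟪e j, x⟫_ℂ)) • e j := by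
      simp_rw [mul_smul, ← Finset.smul_sum, ← mul_smul ((l _ : ℂ))]
      rw [← diagonalOp_apply, hx', smul_smul, inv_mul_cancel₀ hμ0, one_smul]
    rw [hxe]
    refine Submodule.sum_mem _ fun j _ => ?_
    by_cases hj : ⟪e j, x⟫_ℂ = 0
    · simp [hj]
    · exact Submodule.smul_mem _ _ (Submodule.subset_span ⟨⟨j, hcoef j hj⟩, rfl⟩)
  · rw [Submodule.span_le]
    rintro _ ⟨⟨j, hj⟩, rfl⟩
    refine Submodule.mem_iSup_of_mem (l j) (Submodule.mem_iSup_of_mem hj ?_)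
    rw [Module.End.mem_eigenspace_iff]
    change diagonalOp l e (e j) = (l j : ℂ) • e j
    rw [diagonalOp_apply, Finset.sum_eq_single j]
    · simp [he.1 j]
    · intro i _ hi
      simp [he.2 hi]
    · simp

variable [CompleteSpace H]

theorem singularNumber_diagonalOp (he : Orthonormal ℂ e) (hl : Antitone l)
    (hl0 : ∀ i < r, 0 < l i) (hlz : ∀ i, r ≤ i → l i = 0) (j : ℕ) :
    singularNumber (diagonalOp l e) j = l j := by
  have hnn : ∀ i, 0 ≤ l i := fun i => by
    rcases lt_or_ge i r with hi | hi
    · exact (hl0 i hi).le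
    · exact (hlz i hi).ge
  have habs : CFC.abs (diagonalOp l e) = diagonalOp l e :=
    CFC.abs_of_nonneg _ (diagonalOp_nonneg hnn)
  have hset : {t : ℝ | 0 < t ∧ ((j + 1 : ℕ) : Cardinal) ≤ Module.rank ℂ
      ↥(⨆ (μ : ℝ) (_ : t ≤ μ), Module.End.eigenspace
        (diagonalOp l e).toLinearMap (μ : ℂ))} = Set.Ioc 0 (l j) := by
    ext t
    simp only [Set.mem_ofPred_eq, Set.mem_Ioc]
    refine and_congr_right fun ht => ?_
    rw [iSup_eigenspace_diagonalOp he ht]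
    have hli : LinearIndependent ℂ fun i : {i : Fin r // t ≤ l i} => e i :=
      he.linearIndependent.comp _ Subtype.val_injective
    have hfin : FiniteDimensional ℂ (Submodule.span ℂ
        (Set.range fun i : {i : Fin r // t ≤ l i} => e i)) :=
      FiniteDimensional.span_of_finite ℂ (Set.finite_range _)
    have hrank : Module.rank ℂ (Submodule.span ℂ
        (Set.range fun i : {i : Fin r // t ≤ l i} => e i)) =
        (Fintype.card {i : Fin r // t ≤ l i} : Cardinal) := by
      rw [← Module.finrank_eq_rank, finrank_span_eq_card hli]
    rw [hrank, Nat.cast_le, Fintype.card_subtype]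
    constructor
    · intro h
      by_contra! hlt
      have hsub : (Finset.univ.filter fun i : Fin r => t ≤ l i).map Fin.valEmbedding ⊆
          Finset.range j := by
        intro i hi
        obtain ⟨k, hk, rfl⟩ := Finset.mem_map.1 hi
        have hk' := (Finset.mem_filter.1 hk).2
        rw [Finset.mem_range]
        by_contra! hjk
        exact absurd (hk'.trans (hl hjk)) (not_le.2 hlt)
      have := Finset.card_le_card hsub
      rw [Finset.card_map, Finset.card_range] at this
      omega
    · intro h
      have hjr : j < r := by
        by_contra! hj
        rw [hlz j hj] at h
        exact absurd h (not_le.2 ht)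
      have hsub : Finset.range (j + 1) ⊆
          (Finset.univ.filter fun i : Fin r => t ≤ l i).map Fin.valEmbedding := by
        intro i hi
        have hij : i ≤ j := Nat.lt_succ_iff.1 (Finset.mem_range.1 hi)
        exact Finset.mem_map.2 ⟨⟨i, hij.trans_lt hjr⟩,
          Finset.mem_filter.2 ⟨Finset.mem_univ _, h.trans (hl hij)⟩, rfl⟩
      have := Finset.card_le_card hsub
      rwa [Finset.card_map, Finset.card_range] at this
  rw [singularNumber, habs, hset]
  rcases (hnn j).eq_or_lt with h | h
  -- If `l j = 0` no `t` is admissible, and the convention `sSup ∅ = 0` gives the right value.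
  · rw [← h, Set.Ioc_self, Real.sSup_empty]
  · exact csSup_Ioc h

end Diagonal

variable [CompleteSpace H]

/-- The weights `(j + 1)^(-1 + 1/p)` of the `(p, 1)` Lorentz norm. -/
noncomputable def weight (p : ℝ≥0∞) (j : ℕ) : ℝ := ((j : ℝ) + 1) ^ (-1 + p⁻¹.toReal)

theorem weight_pos (p : ℝ≥0∞) (j : ℕ) : 0 < weight p j := by
  unfold weight
  positivity

theorem toReal_inv_le_one {p : ℝ≥0∞} (hp : 1 ≤ p) : p⁻¹.toReal ≤ 1 :=
  ENNReal.toReal_le_of_le_ofReal zero_le_one (by simpa using hp)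

theorem weight_antitone {p : ℝ≥0∞} (hp : 1 ≤ p) : Antitone (weight p) := by
  intro i j hij
  have := toReal_inv_le_one hp
  refine Real.rpow_le_rpow_of_nonpos (by positivity) ?_ (by linarith)
  have : (i : ℝ) ≤ j := by exact_mod_cast hij
  linarith

section Norm

variable {n r : ℕ} {σ : Fin n → (H →L[ℂ] H)} {l : ℕ → ℝ} {e : Fin r → H}
  {u : Fin r → PiLp 2 (fun _ : Fin n => H)}

/-- `∑ S_i* S_i` is `C*C` for the column `C`. Orthonormality of the `u_i` makes it the square of the
diagonal operator, and positive square roots are unique. -/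
theorem IsSVD.sqrt_sum_eq_diagonalOp (h : IsSVD (column σ) l e u) :
    CFC.sqrt (∑ i, star (σ i) * σ i) = diagonalOp l e := by
  refine CFC.sqrt_unique ?_ (diagonalOp_nonneg h.nonneg)
  ext x
  refine ext_inner_left ℂ fun y => ?_
  have h1 : ⟪y, (∑ i, star (σ i) * σ i) x⟫_ℂ = ⟪column σ y, column σ x⟫_ℂ := by
    rw [inner_column, sum_apply, inner_sum]
    refine Finset.sum_congr rfl fun i _ => ?_
    rw [mul_apply_eq_comp, ContinuousLinearMap.star_eq_adjoint,
      ContinuousLinearMap.adjoint_inner_right]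
  rw [h1, h.apply y, h.apply x, h.right.inner_sum, mul_apply_eq_comp,
    diagonalOp_apply, inner_sum]
  refine Finset.sum_congr rfl fun i _ => ?_
  rw [inner_diagonalOp h.left, inner_smul_right, map_mul, Complex.conj_ofReal, inner_conj_symm]
  ring

/-- The Lorentz norm of a tuple in terms of a singular value decomposition of its column. -/
theorem IsSVD.tupleLorentzNorm_eq (h : IsSVD (column σ) l e u) (p : ℝ≥0∞) :
    tupleLorentzNorm p σ = ENNReal.ofReal (∑ i : Fin r, weight p i * l i) := by
  rw [tupleLorentzNorm, h.sqrt_sum_eq_diagonalOp, lorentzNorm]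
  simp_rw [singularNumber_diagonalOp h.left h.antitone h.pos h.eq_zero]
  rw [tsum_eq_sum (s := Finset.range r), Fin.sum_univ_eq_sum_range (fun i => weight p i * l i),
    ENNReal.ofReal_sum_of_nonneg fun i _ => mul_nonneg (weight_pos p i).le (h.nonneg i)]
  · exact Finset.sum_congr rfl fun i _ => by rw [mul_comm]; rfl
  · intro j hj
    rw [h.eq_zero j (by simpa using hj), zero_mul, ENNReal.ofReal_zero]

end Norm

theorem exists_isSVD_column {n : ℕ} {σ : Fin n → (H →L[ℂ] H)}
    (hσ : ∀ i, FiniteDimensional ℂ (σ i).toLinearMap.range) :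
    ∃ (r : ℕ) (l : ℕ → ℝ) (e : Fin r → H) (u : Fin r → PiLp 2 (fun _ : Fin n => H)),
      IsSVD (column σ) l e u :=
  exists_isSVD _ (finiteDimensional_range_column hσ)

/-- Testing the column of a tuple against orthonormal systems bounds its Lorentz norm below. -/
theorem ofReal_sum_re_inner_le_tupleLorentzNorm {n : ℕ} {σ : Fin n → (H →L[ℂ] H)}
    (hσ : ∀ i, FiniteDimensional ℂ (σ i).toLinearMap.range) {p : ℝ≥0∞} (hp : 1 ≤ p)
    {k : ℕ} {v : Fin k → ℝ} (hv0 : ∀ j, 0 ≤ v j) (hv : ∀ j : Fin k, v j ≤ weight p j)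
    {x : Fin k → H} (hx : Orthonormal ℂ x)
    {f : Fin k → PiLp 2 (fun _ : Fin n => H)} (hf : Orthonormal ℂ f) :
    ENNReal.ofReal (∑ j, v j * (⟪f j, column σ (x j)⟫_ℂ).re) ≤ tupleLorentzNorm p σ := by
  obtain ⟨r, l, e, u, h⟩ := exists_isSVD_column hσ
  rw [h.tupleLorentzNorm_eq]
  exact ENNReal.ofReal_le_ofReal
    (h.sum_re_inner_le (weight_antitone hp) (fun j => (weight_pos p j).le) hv0 hv hx hf)

/-- The Lorentz norm of the midpoint of two tuples of finite rank. -/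
theorem tupleLorentzNorm_midpoint_le {n : ℕ} {σ σ₁ σ₂ : Fin n → (H →L[ℂ] H)}
    (hσ : ∀ i, FiniteDimensional ℂ (σ i).toLinearMap.range)
    (hσ₁ : ∀ i, FiniteDimensional ℂ (σ₁ i).toLinearMap.range)
    (hσ₂ : ∀ i, FiniteDimensional ℂ (σ₂ i).toLinearMap.range)
    (hmid : ∀ i, (2 : ℂ) • σ i = σ₁ i + σ₂ i) {p : ℝ≥0∞} (hp : 1 ≤ p) {c : ℝ≥0∞}
    (h₁ : tupleLorentzNorm p σ₁ ≤ c) (h₂ : tupleLorentzNorm p σ₂ ≤ c) :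
    tupleLorentzNorm p σ ≤ c := by
  rcases eq_or_ne c ∞ with rfl | hc
  · exact le_top
  obtain ⟨r, l, e, u, h⟩ := exists_isSVD_column hσ
  -- Convexity by duality: both endpoints are tested on the singular vectors of the midpoint, where
  -- the midpoint attains its norm.
  have key := fun {σ' : Fin n → (H →L[ℂ] H)}
      (hσ' : ∀ i, FiniteDimensional ℂ (σ' i).toLinearMap.range)
      (h' : tupleLorentzNorm p σ' ≤ c) =>
    (ENNReal.ofReal_le_iff_le_toReal hc).1 ((ofReal_sum_re_inner_le_tupleLorentzNorm hσ' hp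
      (v := fun j => weight p j) (fun j => (weight_pos p j).le) (fun _ => le_rfl)
      h.left h.right).trans h')
  have k₁ := key hσ₁ h₁
  have k₂ := key hσ₂ h₂
  rw [h.tupleLorentzNorm_eq, ENNReal.ofReal_le_iff_le_toReal hc]
  have hsum : 2 * ∑ i : Fin r, weight p i * l i =
      ∑ j : Fin r, weight p j * (⟪u j, column σ₁ (e j)⟫_ℂ).re +
        ∑ j : Fin r, weight p j * (⟪u j, column σ₂ (e j)⟫_ℂ).re := by
    rw [Finset.mul_sum, ← Finset.sum_add_distrib]
    refine Finset.sum_congr rfl fun i _ => ?_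
    have hcol : column σ₁ (e i) + column σ₂ (e i) = (2 : ℂ) • column σ (e i) := by
      ext a
      have := congrArg (fun T : H →L[ℂ] H => T (e i)) (hmid a)
      exact this.symm
    rw [← mul_add, ← Complex.add_re, ← inner_add_right, hcol, inner_smul_right,
      h.inner_apply_left]
    norm_num
    ring
  linarith

end LorentzNorm

section Ampliations

open scoped ComplexOrder

/-! ### Commutators of tuples -/

section Commutators

variable {H : Type*} [NormedAddCommGroup H] [InnerProductSpace ℂ H]

theorem finiteDimensional_range_commutator {A : H →L[ℂ] H}
    (hA : FiniteDimensional ℂ A.toLinearMap.range) {n : ℕ} (τ : Fin n → (H →L[ℂ] H)) (i : Fin n) :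
    FiniteDimensional ℂ (tupleCommutator τ A i).toLinearMap.range := by
  have : (tupleCommutator τ A i).toLinearMap.range ≤
      A.toLinearMap.range.map (τ i).toLinearMap ⊔ A.toLinearMap.range := by
    rintro _ ⟨x, rfl⟩
    exact Submodule.sub_mem _
      (Submodule.mem_sup_left (Submodule.mem_map_of_mem (f := (τ i).toLinearMap) ⟨x, rfl⟩))
      (Submodule.mem_sup_right ⟨τ i x, rfl⟩)
  exact Submodule.finiteDimensional_of_le this

theorem column_add {n : ℕ} (σ₁ σ₂ : Fin n → (H →L[ℂ] H)) :
    column (σ₁ + σ₂) = column σ₁ + column σ₂ := by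
  ext x i
  rfl

theorem column_smul {n : ℕ} (c : ℂ) (σ : Fin n → (H →L[ℂ] H)) :
    column (c • σ) = c • column σ := by
  ext x i
  rfl

theorem tupleCommutator_add {n : ℕ} (τ : Fin n → (H →L[ℂ] H)) (A B : H →L[ℂ] H) :
    tupleCommutator τ (A + B) = tupleCommutator τ A + tupleCommutator τ B := by
  ext i x
  simp only [tupleCommutator, mul_add, add_mul, Pi.add_apply]
  abel_nf

theorem tupleCommutator_smul {n : ℕ} (τ : Fin n → (H →L[ℂ] H)) (c : ℂ) (A : H →L[ℂ] H) :
    tupleCommutator τ (c • A) = c • tupleCommutator τ A := by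
  ext i x
  simp [tupleCommutator, smul_sub]

end Commutators

/-! ### Positive contractions of finite rank -/

section Contractions

variable {H : Type*} [NormedAddCommGroup H] [InnerProductSpace ℂ H] [CompleteSpace H]

/-- A contraction whose range is fixed by a projection `Q` is dominated by `Q`. -/
theorem le_of_isStarProjection_mul_eq {A Q : H →L[ℂ] H} (hA0 : 0 ≤ A) (hA1 : A ≤ 1)
    (hQ : IsStarProjection Q) (h : Q * A = A) : A ≤ Q := by
  have h' : A * Q = A := by
    have := congrArg star h
    rwa [star_mul, hQ.isSelfAdjoint.star_eq, (IsSelfAdjoint.of_nonneg hA0).star_eq] at this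
  have h1 := hQ.isSelfAdjoint.conjugate_nonneg (sub_nonneg.2 hA1)
  rw [mul_sub, sub_mul, mul_one, hQ.isIdempotentElem.eq, h, h'] at h1
  exact sub_nonneg.1 h1

/-- `⟪T x, x⟫ = ‖T^{1/2} x‖²`. -/
theorem apply_eq_zero_of_inner_eq_zero {T : H →L[ℂ] H} (hT : 0 ≤ T) {x : H}
    (hx : ⟪T x, x⟫_ℂ = 0) : T x = 0 := by
  have hs : CFC.sqrt T * CFC.sqrt T = T := CFC.sqrt_mul_sqrt_self T hT
  have hsa := ((ContinuousLinearMap.nonneg_iff_isPositive _).1 (CFC.sqrt_nonneg T)).isSymmetric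
  have h1 : T x = CFC.sqrt T (CFC.sqrt T x) := by
    nth_rewrite 1 [← hs]
    rfl
  have h2 : ⟪CFC.sqrt T x, CFC.sqrt T x⟫_ℂ = 0 := by
    rw [← hx, h1]
    exact (hsa (CFC.sqrt T x) x).symm
  rw [h1, inner_self_eq_zero.1 h2, map_zero]

/-- A contraction dominating the projection onto `E` is the identity on `E`. -/
theorem apply_eq_self_of_starProjection_le {A : H →L[ℂ] H} (hA1 : A ≤ 1) {E : Submodule ℂ H}
    [E.HasOrthogonalProjection] (hE : E.starProjection ≤ A) {x : H} (hx : x ∈ E) : A x = x := by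
  have h0 : 0 ≤ 1 - A := sub_nonneg.2 hA1
  have hre : 0 ≤ ⟪(A - E.starProjection) x, x⟫_ℂ :=
    ((ContinuousLinearMap.nonneg_iff_isPositive _).1 (sub_nonneg.2 hE)).inner_nonneg_left x
  have hre' : 0 ≤ ⟪(1 - A) x, x⟫_ℂ :=
    ((ContinuousLinearMap.nonneg_iff_isPositive _).1 h0).inner_nonneg_left x
  have hEx : (A - E.starProjection) x = - ((1 - A) x) := by
    simp [Submodule.starProjection_eq_self_iff.2 hx]
  rw [hEx, inner_neg_left] at hre
  have h := apply_eq_zero_of_inner_eq_zero h0 (le_antisymm (neg_nonneg.1 hre) hre')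
  rw [sub_apply, sub_eq_zero] at h
  exact h.symm

theorem starProjection_mem_finiteRankContractions (E : Submodule ℂ H) [FiniteDimensional ℂ E] :
    E.starProjection ∈ finiteRankContractions H := by
  have hP : IsStarProjection E.starProjection := isStarProjection_starProjection
  refine ⟨hP.nonneg, hP.le_one, ?_⟩
  have : E.starProjection.toLinearMap.range ≤ E := by
    rintro _ ⟨x, rfl⟩
    exact Submodule.starProjection_apply_mem E x
  exact Submodule.finiteDimensional_of_le this

theorem le_starProjection {A : H →L[ℂ] H} (hA : A ∈ finiteRankContractions H)
    {E : Submodule ℂ H} [FiniteDimensional ℂ E] (hE : A.toLinearMap.range ≤ E) :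
    A ≤ E.starProjection := by
  refine le_of_isStarProjection_mul_eq hA.1 hA.2.1 isStarProjection_starProjection ?_
  ext x
  exact Submodule.starProjection_eq_self_iff.2 (hE ⟨x, rfl⟩)

instance : Nonempty (finiteRankContractions H) :=
  ⟨⟨_, starProjection_mem_finiteRankContractions ⊥⟩⟩

instance : IsDirectedOrder (finiteRankContractions H) where
  directed A B := by
    have := A.2.2.2
    have := B.2.2.2
    exact ⟨⟨_, starProjection_mem_finiteRankContractions
      ((A : H →L[ℂ] H).toLinearMap.range ⊔ (B : H →L[ℂ] H).toLinearMap.range)⟩,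
      le_starProjection A.2 le_sup_left, le_starProjection B.2 le_sup_right⟩

theorem quasicentralModulus_eq_iSup_iInf (p : ℝ≥0∞) {n : ℕ} (τ : Fin n → (H →L[ℂ] H)) :
    quasicentralModulus p τ = ⨆ A₀ : finiteRankContractions H, ⨅ A ∈ Set.Ici A₀,
      tupleLorentzNorm p (tupleCommutator τ (A : H →L[ℂ] H)) := by
  rw [quasicentralModulus, Filter.atTop_basis.liminf_eq_iSup_iInf]
  simp

theorem exists_tupleLorentzNorm_lt {p : ℝ≥0∞} {n : ℕ} {τ : Fin n → (H →L[ℂ] H)} {c : ℝ≥0∞}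
    (hc : quasicentralModulus p τ < c) (A₀ : finiteRankContractions H) :
    ∃ A ≥ A₀, tupleLorentzNorm p (tupleCommutator τ (A : H →L[ℂ] H)) < c := by
  rw [quasicentralModulus_eq_iSup_iInf] at hc
  have h := (le_iSup (fun A₀ : finiteRankContractions H => ⨅ A ∈ Set.Ici A₀,
    tupleLorentzNorm p (tupleCommutator τ (A : H →L[ℂ] H))) A₀).trans_lt hc
  obtain ⟨A, hA⟩ := iInf_lt_iff.1 h
  obtain ⟨hA', h⟩ := iInf_lt_iff.1 hA
  exact ⟨A, hA', h⟩

/-- Midpoints of positive contractions of finite rank. -/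
theorem midpoint_mem_finiteRankContractions {A B : H →L[ℂ] H}
    (hA : A ∈ finiteRankContractions H) (hB : B ∈ finiteRankContractions H) :
    (2⁻¹ : ℂ) • (A + B) ∈ finiteRankContractions H := by
  have := hA.2.2
  have := hB.2.2
  have h2 : (0 : ℂ) ≤ 2⁻¹ := by norm_num [Complex.le_def]
  refine ⟨?_, ?_, ?_⟩
  · rw [ContinuousLinearMap.nonneg_iff_isPositive]
    exact ((ContinuousLinearMap.nonneg_iff_isPositive _).1 (add_nonneg hA.1 hB.1)).smul_of_nonneg h2
  · rw [← sub_nonneg, ContinuousLinearMap.nonneg_iff_isPositive]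
    have := ((ContinuousLinearMap.nonneg_iff_isPositive _).1
      (add_nonneg (sub_nonneg.2 hA.2.1) (sub_nonneg.2 hB.2.1))).smul_of_nonneg h2
    convert this using 1
    module
  · have : ((2⁻¹ : ℂ) • (A + B)).toLinearMap.range ≤ A.toLinearMap.range ⊔ B.toLinearMap.range := by
      rintro _ ⟨x, rfl⟩
      exact Submodule.smul_mem _ _ (Submodule.add_mem _ (Submodule.mem_sup_left ⟨x, rfl⟩)
        (Submodule.mem_sup_right ⟨x, rfl⟩))
    exact Submodule.finiteDimensional_of_le this

theorem le_midpoint {A B C : H →L[ℂ] H} (hA : C ≤ A) (hB : C ≤ B) :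
    C ≤ (2⁻¹ : ℂ) • (A + B) := by
  have h2 : (0 : ℂ) ≤ 2⁻¹ := by norm_num [Complex.le_def]
  rw [← sub_nonneg, ContinuousLinearMap.nonneg_iff_isPositive]
  have := ((ContinuousLinearMap.nonneg_iff_isPositive _).1
    (add_nonneg (sub_nonneg.2 hA) (sub_nonneg.2 hB))).smul_of_nonneg h2
  convert this using 1
  module

/-! ### Commutators small in operator norm -/

theorem norm_column_commutator_sq_le {n : ℕ} (τ : Fin n → (H →L[ℂ] H)) {A : H →L[ℂ] H}
    (hA : A ∈ finiteRankContractions H) (x : H) :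
    ‖column (tupleCommutator τ A) x‖ ^ 2 ≤ (∑ i, (2 * ‖τ i‖) ^ 2) * ‖x‖ ^ 2 := by
  have hA1 : ‖A‖ ≤ 1 := (CStarAlgebra.norm_le_one_iff_of_nonneg A hA.1).2 hA.2.1
  rw [PiLp.norm_sq_eq_of_L2, Finset.sum_mul]
  refine Finset.sum_le_sum fun i _ => ?_
  rw [← mul_pow]
  refine pow_le_pow_left₀ (norm_nonneg _) ?_ 2
  refine ((tupleCommutator τ A i).le_opNorm x).trans
    (mul_le_mul_of_nonneg_right ?_ (norm_nonneg x))
  refine (norm_sub_le (τ i * A) (A * τ i)).trans ?_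
  have h1 := norm_mul_le (τ i) A
  have h2 := norm_mul_le A (τ i)
  nlinarith [norm_nonneg (τ i)]

/-- Beyond a suitable finite-dimensional subspace, commutators have ranges orthogonal to the
range of a given one. -/
theorem exists_inner_column_commutator_eq_zero {n : ℕ} (τ : Fin n → (H →L[ℂ] H)) {A : H →L[ℂ] H}
    (hA : FiniteDimensional ℂ A.toLinearMap.range) :
    ∃ B₀ : finiteRankContractions H, ∀ B ≥ B₀, ∀ x y,
      ⟪column (tupleCommutator τ A) x,
        column (tupleCommutator τ (B : H →L[ℂ] H)) y⟫_ℂ = 0 := by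
  have hfin := finiteDimensional_range_commutator hA τ
  -- If `B` fixes both `z = [τ_i, A] x` and `τ_i* z`, then `⟪z, τ_i B y⟫` and `⟪z, B τ_i y⟫` both
  -- equal `⟪z, τ_i y⟫`.
  let F : Fin n → Submodule ℂ H := fun i => (tupleCommutator τ A i).toLinearMap.range ⊔
    (tupleCommutator τ A i).toLinearMap.range.map (τ i).adjoint.toLinearMap
  refine ⟨⟨_, starProjection_mem_finiteRankContractions (⨆ i, F i)⟩, fun B hB x y => ?_⟩
  have hfix : ∀ z ∈ ⨆ i, F i, (B : H →L[ℂ] H) z = z := fun z hz =>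
    apply_eq_self_of_starProjection_le B.2.2.1 hB hz
  have hsym : ∀ z w, ⟪z, (B : H →L[ℂ] H) w⟫_ℂ = ⟪(B : H →L[ℂ] H) z, w⟫_ℂ := fun z w =>
    (((ContinuousLinearMap.nonneg_iff_isPositive _).1 B.2.1).isSymmetric z w).symm
  rw [inner_column]
  refine Finset.sum_eq_zero fun i _ => ?_
  set z := tupleCommutator τ A i x with hz
  have hz1 : z ∈ ⨆ i, F i :=
    Submodule.mem_iSup_of_mem i (Submodule.mem_sup_left ⟨x, rfl⟩)
  have hz2 : (τ i).adjoint z ∈ ⨆ i, F i :=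
    Submodule.mem_iSup_of_mem i (Submodule.mem_sup_right
      (Submodule.mem_map_of_mem (f := (τ i).adjoint.toLinearMap) ⟨x, rfl⟩))
  change ⟪z, τ i ((B : H →L[ℂ] H) y) - (B : H →L[ℂ] H) (τ i y)⟫_ℂ = 0
  rw [inner_sub_right, hsym, hfix z hz1, ← ContinuousLinearMap.adjoint_inner_left (τ i), hsym,
    hfix _ hz2, ContinuousLinearMap.adjoint_inner_left, sub_self]

/-- Below any bound exceeding the quasicentral modulus, commutators can be made small in operator
norm by taking convex combinations. -/
theorem exists_commutator_small {p : ℝ≥0∞} (hp : 1 ≤ p) {n : ℕ} {τ : Fin n → (H →L[ℂ] H)}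
    {c : ℝ≥0∞} (hc : quasicentralModulus p τ < c) (N : ℕ) :
    ∀ A₀ : finiteRankContractions H, ∃ A ≥ A₀,
      tupleLorentzNorm p (tupleCommutator τ (A : H →L[ℂ] H)) ≤ c ∧
      ∀ x, ‖column (tupleCommutator τ (A : H →L[ℂ] H)) x‖ ^ 2 ≤
        (∑ i, (2 * ‖τ i‖) ^ 2) / 2 ^ N * ‖x‖ ^ 2 := by
  induction N with
  | zero =>
    intro A₀
    obtain ⟨A, hA, h⟩ := exists_tupleLorentzNorm_lt hc A₀
    exact ⟨A, hA, h.le, fun x => by simpa using norm_column_commutator_sq_le τ A.2 x⟩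
  | succ N ih =>
    intro A₀
    obtain ⟨A₁, hA₁, hn₁, hq₁⟩ := ih A₀
    obtain ⟨B₀, hB₀⟩ := exists_inner_column_commutator_eq_zero τ A₁.2.2.2
    obtain ⟨B₁, hB₁, hB₁'⟩ := exists_ge_ge A₀ B₀
    obtain ⟨A₂, hA₂, hn₂, hq₂⟩ := ih B₁
    have horth := hB₀ A₂ (hB₁'.trans hA₂)
    have hmem := midpoint_mem_finiteRankContractions A₁.2 A₂.2
    refine ⟨⟨_, hmem⟩, le_midpoint hA₁ (hB₁.trans hA₂), ?_, fun x => ?_⟩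
    · refine tupleLorentzNorm_midpoint_le (finiteDimensional_range_commutator hmem.2.2 τ)
        (finiteDimensional_range_commutator A₁.2.2.2 τ)
        (finiteDimensional_range_commutator A₂.2.2.2 τ) (fun i => ?_) hp hn₁ hn₂
      rw [tupleCommutator_smul, tupleCommutator_add, Pi.smul_apply, Pi.add_apply, smul_smul]
      norm_num
    -- The cross term vanishes, so two bounds `β` become `(β + β)/4 = β/2`.
    · have h1 : ‖column (tupleCommutator τ ((2⁻¹ : ℂ) • ((A₁ : H →L[ℂ] H) + A₂))) x‖ ^ 2 =
          (‖column (tupleCommutator τ (A₁ : H →L[ℂ] H)) x‖ ^ 2 +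
            ‖column (tupleCommutator τ (A₂ : H →L[ℂ] H)) x‖ ^ 2) / 4 := by
        rw [tupleCommutator_smul, tupleCommutator_add, column_smul, column_add, smul_apply,
          add_apply, norm_smul, mul_pow, @norm_add_sq ℂ, horth]
        norm_num
        ring
      rw [h1, pow_succ (2 : ℝ), ← div_div]
      linarith [hq₁ x, hq₂ x]

end Contractions

/-! ### Ampliations -/

section Ampliation

variable {H : Type*} [NormedAddCommGroup H] [InnerProductSpace ℂ H] {m : ℕ}

/-- The isometric embedding of `H` as the `a`-th summand of `H ⊕ ⋯ ⊕ H`. -/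
noncomputable def embed (a : Fin m) : H →L[ℂ] PiLp 2 (fun _ : Fin m => H) :=
  (PiLp.continuousLinearEquiv 2 ℂ (fun _ : Fin m => H)).symm.toContinuousLinearMap ∘L
    ContinuousLinearMap.single ℂ (fun _ : Fin m => H) a

theorem embed_apply (a b : Fin m) (x : H) : embed a x b = if b = a then x else 0 := by
  change (Pi.single a x : Fin m → H) b = _
  rw [Pi.single_apply]

theorem inner_embed_left (a : Fin m) (x : H) (y : PiLp 2 (fun _ : Fin m => H)) :
    ⟪embed a x, y⟫_ℂ = ⟪x, y a⟫_ℂ := by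
  rw [PiLp.inner_apply, Finset.sum_eq_single a]
  · simp [embed_apply]
  · intro b _ hb
    simp [embed_apply, hb]
  · simp

@[simp]
theorem ampliation_apply (T : H →L[ℂ] H) (y : PiLp 2 (fun _ : Fin m => H)) (a : Fin m) :
    ampliation m T y a = T (y a) := rfl

theorem ampliation_embed (T : H →L[ℂ] H) (a : Fin m) (x : H) :
    ampliation m T (embed a x) = embed a (T x) := by
  ext b
  rw [ampliation_apply, embed_apply, embed_apply]
  split_ifs <;> simp

theorem ampliation_sub (S T : H →L[ℂ] H) :
    ampliation m (S - T) = ampliation m S - ampliation m T := by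
  ext y a
  rfl

theorem ampliation_one : ampliation m (1 : H →L[ℂ] H) = 1 := by
  ext y a
  rfl

theorem ampliation_mul (S T : H →L[ℂ] H) :
    ampliation m (S * T) = ampliation m S * ampliation m T := by
  ext y a
  rfl

theorem tupleCommutator_ampliation {n : ℕ} (τ : Fin n → (H →L[ℂ] H)) (A : H →L[ℂ] H) :
    tupleCommutator (fun i => ampliation m (τ i)) (ampliation m A) =
      fun i => ampliation m (tupleCommutator τ A i) := by
  ext i y a
  rfl

theorem finiteDimensional_range_ampliation {A : H →L[ℂ] H}
    (hA : FiniteDimensional ℂ A.toLinearMap.range) :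
    FiniteDimensional ℂ (ampliation m A).toLinearMap.range := by
  have : (ampliation m A).toLinearMap.range ≤
      ⨆ a : Fin m, A.toLinearMap.range.map (embed a).toLinearMap := by
    rintro _ ⟨y, rfl⟩
    have hy : ampliation m A y = ∑ a, embed a (A (y a)) := by
      ext b
      simp [embed_apply]
    change ampliation m A y ∈ _
    rw [hy]
    exact Submodule.sum_mem _ fun a _ => Submodule.mem_iSup_of_mem a
      (Submodule.mem_map_of_mem (f := (embed a).toLinearMap) ⟨y a, rfl⟩)
  exact Submodule.finiteDimensional_of_le this

/-- The index `k = a + m j` puts the `m` copies of `e j` in consecutive positions, which keeps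
repeated singular values in decreasing order. -/
theorem orthonormal_embed {r : ℕ} {e : Fin r → H} (he : Orthonormal ℂ e) :
    Orthonormal ℂ fun k : Fin (r * m) => (embed k.modNat (e k.divNat) : PiLp 2 _) := by
  rw [orthonormal_iff_ite]
  intro k k'
  rw [inner_embed_left, embed_apply]
  have hkk : k = k' ↔ k.divNat = k'.divNat ∧ k.modNat = k'.modNat := by
    rw [← finProdFinEquiv.symm.injective.eq_iff]
    exact Prod.ext_iff
  have he' := orthonormal_iff_ite.1 he k.divNat k'.divNat
  by_cases h1 : k.modNat = k'.modNat <;> by_cases h2 : k.divNat = k'.divNat <;>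
    simp [hkk, h1, h2] <;> simp_all

/-- The isometric embedding of columns induced by `embed a`. -/
noncomputable def embedColumn (n : ℕ) (a : Fin m) (u : PiLp 2 (fun _ : Fin n => H)) :
    PiLp 2 (fun _ : Fin n => PiLp 2 (fun _ : Fin m => H)) :=
  WithLp.toLp 2 fun i => embed a (u i)

theorem embedColumn_apply (n : ℕ) (a : Fin m) (u : PiLp 2 (fun _ : Fin n => H)) (i : Fin n) :
    embedColumn n a u i = embed a (u i) := rfl

theorem inner_embedColumn_left {n : ℕ} (a : Fin m) (u : PiLp 2 (fun _ : Fin n => H))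
    (y : PiLp 2 (fun _ : Fin n => PiLp 2 (fun _ : Fin m => H))) :
    ⟪embedColumn n a u, y⟫_ℂ = ∑ i, ⟪u i, y i a⟫_ℂ := by
  rw [PiLp.inner_apply]
  exact Finset.sum_congr rfl fun i _ => inner_embed_left _ _ _

theorem orthonormal_embedColumn {n r : ℕ} {u : Fin r → PiLp 2 (fun _ : Fin n => H)}
    (hu : Orthonormal ℂ u) :
    Orthonormal ℂ fun k : Fin (r * m) => embedColumn n k.modNat (u k.divNat) := by
  rw [orthonormal_iff_ite]
  intro k k'
  have hkk : k = k' ↔ k.divNat = k'.divNat ∧ k.modNat = k'.modNat := by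
    rw [← finProdFinEquiv.symm.injective.eq_iff]
    exact Prod.ext_iff
  have hu' := orthonormal_iff_ite.1 hu k.divNat k'.divNat
  rw [PiLp.inner_apply] at hu'
  rw [inner_embedColumn_left]
  simp_rw [embedColumn_apply, embed_apply]
  by_cases h1 : k.modNat = k'.modNat
  · simp only [h1, if_true, hkk, and_true]
    exact hu'
  · simp [h1, hkk]

theorem sum_fin_mul {M : Type*} [AddCommMonoid M] (r m : ℕ) (g : Fin (r * m) → M) :
    ∑ k, g k = ∑ j : Fin r, ∑ a : Fin m, g (finProdFinEquiv (j, a)) := by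
  rw [← Fintype.sum_prod_type', ← finProdFinEquiv.sum_comp]

theorem divNat_finProdFinEquiv {r : ℕ} (j : Fin r) (a : Fin m) :
    (finProdFinEquiv (j, a)).divNat = j :=
  congrArg Prod.fst (finProdFinEquiv.symm_apply_apply (j, a))

theorem modNat_finProdFinEquiv {r : ℕ} (j : Fin r) (a : Fin m) :
    (finProdFinEquiv (j, a)).modNat = a :=
  congrArg Prod.snd (finProdFinEquiv.symm_apply_apply (j, a))

/-- A singular value decomposition of a column yields one of its ampliation, every singular value
being repeated `m` times. -/
theorem IsSVD.ampliation {n r : ℕ} (hm : 1 ≤ m) {σ : Fin n → (H →L[ℂ] H)} {l : ℕ → ℝ}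
    {e : Fin r → H} {u : Fin r → PiLp 2 (fun _ : Fin n => H)} (h : IsSVD (column σ) l e u) :
    IsSVD (column fun i => ampliation m (σ i)) (fun k => l (k / m))
      (fun k : Fin (r * m) => embed k.modNat (e k.divNat))
      (fun k : Fin (r * m) => embedColumn n k.modNat (u k.divNat)) where
  antitone i j hij := h.antitone (Nat.div_le_div_right hij)
  pos i hi := h.pos _ ((Nat.div_lt_iff_lt_mul hm).2 hi)
  eq_zero i hi := h.eq_zero _ ((Nat.le_div_iff_mul_le hm).2 hi)
  left := orthonormal_embed h.left
  right := orthonormal_embedColumn h.right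
  apply y := by
    ext i b
    have h1 : σ i (y b) = ∑ j : Fin r, ((l j : ℂ) * ⟪e j, y b⟫_ℂ) • u j i := by
      have := congrArg (fun v : PiLp 2 (fun _ : Fin n => H) => v i) (h.apply (y b))
      simpa using this
    rw [sum_fin_mul]
    simp only [column_apply, ampliation_apply, WithLp.ofLp_sum, Finset.sum_apply, PiLp.smul_apply, embedColumn_apply,
      embed_apply, divNat_finProdFinEquiv, modNat_finProdFinEquiv, inner_embed_left]
    rw [h1]
    refine Finset.sum_congr rfl fun j _ => ?_
    rw [Finset.sum_eq_single b]
    · have : ((finProdFinEquiv (j, b) : Fin (r * m)) : ℕ) / m = j :=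
        congrArg Fin.val (divNat_finProdFinEquiv j b)
      rw [this, if_pos rfl]
    · intro a _ ha
      simp [ha.symm]
    · simp

variable [CompleteSpace H]

theorem adjoint_embed (a : Fin m) (y : PiLp 2 (fun _ : Fin m => H)) :
    (embed a).adjoint y = y a :=
  ext_inner_left ℂ fun x => by rw [ContinuousLinearMap.adjoint_inner_right, inner_embed_left]

theorem ampliation_nonneg {A : H →L[ℂ] H} (hA : 0 ≤ A) : 0 ≤ ampliation m A := by
  have h : ampliation m A = ∑ a, embed a ∘L A ∘L (embed a).adjoint := by
    ext y b
    simp [embed_apply, adjoint_embed]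
  rw [h, ContinuousLinearMap.nonneg_iff_isPositive]
  exact ContinuousLinearMap.isPositive_sum _ fun a _ =>
    ((ContinuousLinearMap.nonneg_iff_isPositive _).1 hA).conj_adjoint (embed a)

theorem ampliation_mono {A B : H →L[ℂ] H} (h : A ≤ B) : ampliation m A ≤ ampliation m B := by
  rw [← sub_nonneg, ← ampliation_sub]
  exact ampliation_nonneg (sub_nonneg.2 h)

theorem ampliation_mem_finiteRankContractions {A : H →L[ℂ] H}
    (hA : A ∈ finiteRankContractions H) :
    ampliation m A ∈ finiteRankContractions (PiLp 2 (fun _ : Fin m => H)) :=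
  ⟨ampliation_nonneg hA.1, ampliation_one (H := H) (m := m) ▸ ampliation_mono hA.2.1,
    finiteDimensional_range_ampliation hA.2.2⟩

/-- Ampliations are cofinal among the positive contractions of finite rank. -/
theorem exists_le_ampliation
    (B : finiteRankContractions (PiLp 2 (fun _ : Fin m => H))) :
    ∃ A : finiteRankContractions H, (B : PiLp 2 (fun _ : Fin m => H) →L[ℂ] _) ≤
      ampliation m (A : H →L[ℂ] H) := by
  have := B.2.2.2
  -- `E` contains every coordinate of every vector in the range of `B`, so the ampliated projection
  -- onto `E` fixes that range.
  let E : Submodule ℂ H := ⨆ a : Fin m,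
    (B : PiLp 2 (fun _ : Fin m => H) →L[ℂ] _).toLinearMap.range.map
      (embed a).adjoint.toLinearMap
  have hE := starProjection_mem_finiteRankContractions E
  have hP : IsStarProjection E.starProjection := isStarProjection_starProjection
  refine ⟨⟨_, hE⟩, le_of_isStarProjection_mul_eq B.2.1 B.2.2.1
    ⟨?_, .of_nonneg (ampliation_nonneg hE.1)⟩ ?_⟩
  · rw [IsIdempotentElem, ← ampliation_mul, hP.isIdempotentElem.eq]
  · ext y a
    refine Submodule.starProjection_eq_self_iff.2 (Submodule.mem_iSup_of_mem a ?_)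
    exact Submodule.mem_map.2 ⟨(B : PiLp 2 (fun _ : Fin m => H) →L[ℂ] _) y, ⟨y, rfl⟩,
      adjoint_embed a _⟩

/-- The `a`-th diagonal block of an operator on `H ⊕ ⋯ ⊕ H`. -/
noncomputable def block (a : Fin m)
    (B : PiLp 2 (fun _ : Fin m => H) →L[ℂ] PiLp 2 (fun _ : Fin m => H)) : H →L[ℂ] H :=
  (embed a).adjoint ∘L B ∘L embed a

/-- The mean of the diagonal blocks of an operator on `H ⊕ ⋯ ⊕ H`. -/
noncomputable def blockMean
    (B : PiLp 2 (fun _ : Fin m => H) →L[ℂ] PiLp 2 (fun _ : Fin m => H)) : H →L[ℂ] H :=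
  (m : ℂ)⁻¹ • ∑ a, block a B

theorem block_apply (a : Fin m)
    (B : PiLp 2 (fun _ : Fin m => H) →L[ℂ] PiLp 2 (fun _ : Fin m => H)) (x : H) :
    block a B x = B (embed a x) a := adjoint_embed _ _

theorem blockMean_nonneg {B : PiLp 2 (fun _ : Fin m => H) →L[ℂ] PiLp 2 (fun _ : Fin m => H)}
    (hB : 0 ≤ B) : 0 ≤ blockMean B := by
  rw [ContinuousLinearMap.nonneg_iff_isPositive]
  refine (ContinuousLinearMap.isPositive_sum _ fun a _ =>
    ((ContinuousLinearMap.nonneg_iff_isPositive _).1 hB).adjoint_conj (embed a)).smul_of_nonneg ?_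
  rw [inv_nonneg]
  exact Nat.cast_nonneg m

theorem blockMean_sub (B C : PiLp 2 (fun _ : Fin m => H) →L[ℂ] PiLp 2 (fun _ : Fin m => H)) :
    blockMean (B - C) = blockMean B - blockMean C := by
  simp [blockMean, block, ContinuousLinearMap.sub_comp, ContinuousLinearMap.comp_sub,
    Finset.sum_sub_distrib, smul_sub]

theorem blockMean_mono {B C : PiLp 2 (fun _ : Fin m => H) →L[ℂ] PiLp 2 (fun _ : Fin m => H)}
    (h : B ≤ C) : blockMean B ≤ blockMean C := by
  rw [← sub_nonneg, ← blockMean_sub]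
  exact blockMean_nonneg (sub_nonneg.2 h)

/-- Together with monotonicity, this sends every `B ≥ A ⊗ I` to a mean above `A`, as needed for the
lower limits. -/
theorem blockMean_ampliation (hm : 1 ≤ m) (A : H →L[ℂ] H) : blockMean (ampliation m A) = A := by
  have hm0 : (m : ℂ) ≠ 0 := by exact_mod_cast (Nat.one_le_iff_ne_zero.1 hm)
  have h : ∀ a : Fin m, block a (ampliation m A) = A := fun a => by
    ext x
    rw [block_apply, ampliation_embed, embed_apply, if_pos rfl]
  simp only [blockMean, h, Finset.sum_const, Finset.card_univ, Fintype.card_fin]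
  rw [← Nat.cast_smul_eq_nsmul ℂ, smul_smul, inv_mul_cancel₀ hm0, one_smul]

theorem blockMean_mem_finiteRankContractions (hm : 1 ≤ m)
    {B : PiLp 2 (fun _ : Fin m => H) →L[ℂ] PiLp 2 (fun _ : Fin m => H)}
    (hB : B ∈ finiteRankContractions (PiLp 2 (fun _ : Fin m => H))) :
    blockMean B ∈ finiteRankContractions H := by
  refine ⟨blockMean_nonneg hB.1, ?_, ?_⟩
  · have := blockMean_mono hB.2.1
    rwa [← ampliation_one, blockMean_ampliation hm] at this
  · have := hB.2.2
    have hle : (blockMean B).toLinearMap.range ≤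
        ⨆ a : Fin m, B.toLinearMap.range.map (embed a).adjoint.toLinearMap := by
      rintro _ ⟨x, rfl⟩
      have hx : blockMean B x = (m : ℂ)⁻¹ • ∑ a, (embed a).adjoint (B (embed a x)) := by
        rw [blockMean, smul_apply, sum_apply]
        rfl
      rw [ContinuousLinearMap.coe_coe, hx]
      refine Submodule.smul_mem _ _ (Submodule.sum_mem _ fun a _ => Submodule.mem_iSup_of_mem a ?_)
      exact Submodule.mem_map.2 ⟨B (embed a x), ⟨embed a x, rfl⟩, rfl⟩
    exact Submodule.finiteDimensional_of_le hle

/-- `T ⊕ ⋯ ⊕ T` acts summand by summand, so compressing to a summand commutes with taking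
commutators. -/
theorem tupleCommutator_ampliation_embed_apply {n : ℕ} (τ : Fin n → (H →L[ℂ] H))
    (B : PiLp 2 (fun _ : Fin m => H) →L[ℂ] PiLp 2 (fun _ : Fin m => H)) (i : Fin n) (a : Fin m)
    (x : H) :
    tupleCommutator (fun i => ampliation m (τ i)) B i (embed a x) a =
      tupleCommutator τ (block a B) i x := by
  change τ i (B (embed a x) a) - B (ampliation m (τ i) (embed a x)) a =
    τ i (block a B x) - block a B (τ i x)
  rw [block_apply, block_apply, ampliation_embed]

theorem sum_tupleCommutator_block (hm : 1 ≤ m) {n : ℕ} (τ : Fin n → (H →L[ℂ] H))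
    (B : PiLp 2 (fun _ : Fin m => H) →L[ℂ] PiLp 2 (fun _ : Fin m => H)) (i : Fin n) :
    ∑ a, tupleCommutator τ (block a B) i = (m : ℂ) • tupleCommutator τ (blockMean B) i := by
  have hm0 : (m : ℂ) ≠ 0 := by exact_mod_cast (Nat.one_le_iff_ne_zero.1 hm)
  have h : ∑ a, block a B = (m : ℂ) • blockMean B := by
    rw [blockMean, smul_smul, mul_inv_cancel₀ hm0, one_smul]
  rw [← Pi.smul_apply, ← tupleCommutator_smul, ← h]
  simp only [tupleCommutator, Finset.sum_sub_distrib, Finset.mul_sum, Finset.sum_mul]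

/-- Diagonal matrix coefficients of the commutator with the ampliation of a tuple average to those
of the commutator with the mean of the diagonal blocks. -/
theorem sum_inner_embedColumn_commutator (hm : 1 ≤ m) {n : ℕ} (τ : Fin n → (H →L[ℂ] H))
    (B : PiLp 2 (fun _ : Fin m => H) →L[ℂ] PiLp 2 (fun _ : Fin m => H)) (x : H)
    (u : PiLp 2 (fun _ : Fin n => H)) :
    ∑ a, ⟪embedColumn n a u,
      column (tupleCommutator (fun i => ampliation m (τ i)) B) (embed a x)⟫_ℂ =
      m * ⟪u, column (tupleCommutator τ (blockMean B)) x⟫_ℂ := by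
  simp_rw [inner_embedColumn_left, column_apply, tupleCommutator_ampliation_embed_apply]
  rw [Finset.sum_comm, PiLp.inner_apply, Finset.mul_sum]
  refine Finset.sum_congr rfl fun i _ => ?_
  rw [← inner_sum, ← sum_apply, sum_tupleCommutator_block hm, smul_apply, inner_smul_right]
  rfl

end Ampliation

end Ampliations

section Formula

/-! ### Weights along blocks -/

/-- `a + m j + 1 ≤ m (j + 1)` and the exponent is nonpositive. -/
theorem natCast_rpow_mul_weight_le {m : ℕ} (hm : 1 ≤ m) {p : ℝ≥0∞} (hp : 1 ≤ p) (j : ℕ) {a : ℕ}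
    (ha : a < m) : (m : ℝ) ^ (-1 + p⁻¹.toReal) * weight p j ≤ weight p (a + m * j) := by
  have hs := toReal_inv_le_one hp
  have hm' : (0 : ℝ) < m := by exact_mod_cast hm
  rw [weight, weight, ← Real.mul_rpow hm'.le (by positivity)]
  refine Real.rpow_le_rpow_of_nonpos (by positivity) ?_ (by linarith)
  have : (a : ℝ) + 1 ≤ m := by exact_mod_cast ha
  push_cast
  linarith

theorem mul_natCast_rpow_eq {m : ℕ} (hm : 1 ≤ m) (s : ℝ) :
    (m : ℝ) * (m : ℝ) ^ (-1 + s) = (m : ℝ) ^ s := by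
  have hm' : (0 : ℝ) < m := by exact_mod_cast hm
  rw [Real.rpow_add hm', Real.rpow_neg_one, ← mul_assoc, mul_inv_cancel₀ hm'.ne', one_mul]

/-- Bounding `a + m j + 1` below by `m j` gives `(m j)^{-1+1/p}`. Replacing `j` by `j + 1` costs a
factor `((j+1)/j)^{1-1/p} ≤ 1 + 1/j ≤ 1 + 1/J`. -/
theorem weight_le_of_le {m : ℕ} (hm : 1 ≤ m) {p : ℝ≥0∞} (hp : 1 ≤ p) {J j : ℕ} (hJ : 1 ≤ J)
    (hj : J ≤ j) (a : ℕ) :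
    weight p (a + m * j) ≤ (m : ℝ) ^ (-1 + p⁻¹.toReal) * ((1 + 1 / (J : ℝ)) * weight p j) := by
  have hs := toReal_inv_le_one hp
  have hs0 : 0 ≤ p⁻¹.toReal := ENNReal.toReal_nonneg
  have hm' : (0 : ℝ) < m := by exact_mod_cast hm
  have hJ' : (0 : ℝ) < J := by exact_mod_cast hJ
  have hjJ : (J : ℝ) ≤ j := by exact_mod_cast hj
  have hj' : (0 : ℝ) < j := hJ'.trans_le hjJ
  have h1 : weight p (a + m * j) ≤ ((m : ℝ) * j) ^ (-1 + p⁻¹.toReal) := by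
    refine Real.rpow_le_rpow_of_nonpos (by positivity) ?_ (by linarith)
    push_cast
    linarith [(Nat.cast_nonneg a : (0 : ℝ) ≤ a)]
  have h2 : (j : ℝ) ^ (-1 + p⁻¹.toReal) ≤ (1 + 1 / (J : ℝ)) * weight p j := by
    have h3 : (j : ℝ) ^ (-1 + p⁻¹.toReal) =
        (((j : ℝ) + 1) / j) ^ (1 - p⁻¹.toReal) * weight p j := by
      rw [weight, Real.div_rpow (by positivity) hj'.le, div_mul_eq_mul_div,
        ← Real.rpow_add (by positivity), div_eq_mul_inv, ← Real.rpow_neg hj'.le]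
      ring_nf
      simp
    rw [h3]
    refine mul_le_mul_of_nonneg_right ?_ (weight_pos p j).le
    have h4 : (1 : ℝ) ≤ ((j : ℝ) + 1) / j := by
      rw [one_le_div hj']
      linarith
    calc (((j : ℝ) + 1) / j) ^ (1 - p⁻¹.toReal) ≤ (((j : ℝ) + 1) / j) ^ (1 : ℝ) :=
          Real.rpow_le_rpow_of_exponent_le h4 (by linarith)
      _ = 1 + 1 / j := by
          rw [Real.rpow_one, add_div, div_self hj'.ne']
      _ ≤ 1 + 1 / J := by gcongr
  rw [Real.mul_rpow hm'.le hj'.le] at h1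
  exact h1.trans (mul_le_mul_of_nonneg_left h2 (by positivity))

theorem weight_le_one {p : ℝ≥0∞} (hp : 1 ≤ p) (j : ℕ) : weight p j ≤ 1 := by
  refine (weight_antitone hp j.zero_le).trans ?_
  simp [weight]

theorem natCast_rpow_eq_ofReal {m : ℕ} (hm : 1 ≤ m) (s : ℝ) :
    (m : ℝ≥0∞) ^ s = ENNReal.ofReal ((m : ℝ) ^ s) := by
  have hm' : (0 : ℝ) < m := by exact_mod_cast hm
  rw [← ENNReal.ofReal_rpow_of_pos hm', ENNReal.ofReal_natCast]

/-! ### The ampliation formula -/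

variable {H : Type*} [NormedAddCommGroup H] [InnerProductSpace ℂ H] [CompleteSpace H] {m n : ℕ}

theorem rpow_mul_tupleLorentzNorm_blockMean_le (hm : 1 ≤ m) {p : ℝ≥0∞} (hp : 1 ≤ p)
    (τ : Fin n → (H →L[ℂ] H))
    {B : PiLp 2 (fun _ : Fin m => H) →L[ℂ] PiLp 2 (fun _ : Fin m => H)}
    (hB : B ∈ finiteRankContractions (PiLp 2 (fun _ : Fin m => H))) :
    (m : ℝ≥0∞) ^ p⁻¹.toReal * tupleLorentzNorm p (tupleCommutator τ (blockMean B)) ≤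
      tupleLorentzNorm p (tupleCommutator (fun i => ampliation m (τ i)) B) := by
  obtain ⟨r, l, e, u, h⟩ := exists_isSVD_column
    (finiteDimensional_range_commutator (blockMean_mem_finiteRankContractions hm hB).2.2 τ)
  have key := ofReal_sum_re_inner_le_tupleLorentzNorm
    (finiteDimensional_range_commutator hB.2.2 fun i => ampliation m (τ i)) hp
    -- These weights are constant on each block of `m` positions, so that the block sum sees only
    -- the mean of the diagonal blocks.
    (v := fun k : Fin (r * m) => (m : ℝ) ^ (-1 + p⁻¹.toReal) * weight p k.divNat)
    (fun k => mul_nonneg (by positivity) (weight_pos p _).le)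
    (fun k => by
      have := natCast_rpow_mul_weight_le hm hp (k.divNat : ℕ) k.modNat.2
      have hk : (k.modNat : ℕ) + m * (k.divNat : ℕ) = k := by
        simp [Nat.mod_add_div]
      rwa [hk] at this)
    (orthonormal_embed h.left) (orthonormal_embedColumn h.right)
  refine le_trans (le_of_eq ?_) key
  rw [h.tupleLorentzNorm_eq, natCast_rpow_eq_ofReal hm, ← ENNReal.ofReal_mul (by positivity),
    sum_fin_mul]
  congr 1
  rw [Finset.mul_sum]
  refine Finset.sum_congr rfl fun j _ => ?_
  simp only [divNat_finProdFinEquiv, modNat_finProdFinEquiv]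
  rw [← Finset.mul_sum, ← Complex.re_sum, sum_inner_embedColumn_commutator hm,
    h.inner_apply_left, ← mul_natCast_rpow_eq hm, ← Complex.ofReal_natCast, ← Complex.ofReal_mul,
    Complex.ofReal_re]
  ring

theorem rpow_mul_quasicentralModulus_le (hm : 1 ≤ m) {p : ℝ≥0∞} (hp : 1 ≤ p)
    (τ : Fin n → (H →L[ℂ] H)) :
    (m : ℝ≥0∞) ^ p⁻¹.toReal * quasicentralModulus p τ ≤
      quasicentralModulus p fun i => ampliation m (τ i) := by
  rw [quasicentralModulus_eq_iSup_iInf, quasicentralModulus_eq_iSup_iInf, ENNReal.mul_iSup]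
  refine iSup_le fun A₀ => ?_
  refine le_iSup_of_le ⟨_, ampliation_mem_finiteRankContractions A₀.2⟩ (le_iInf₂ fun B hB => ?_)
  refine le_trans ?_ (rpow_mul_tupleLorentzNorm_blockMean_le hm hp τ B.2)
  gcongr
  refine iInf₂_le_of_le ⟨_, blockMean_mem_finiteRankContractions hm B.2⟩ ?_ le_rfl
  have := blockMean_mono hB
  rwa [blockMean_ampliation hm] at this

/-- The Lorentz norm of an ampliation exceeds `m^{1/p}` times the original one by at most a small
multiple of the latter and a large multiple of the operator norm. -/
theorem tupleLorentzNorm_ampliation_le (hm : 1 ≤ m) {p : ℝ≥0∞} (hp : 1 ≤ p)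
    {σ : Fin n → (H →L[ℂ] H)} (hσ : ∀ i, FiniteDimensional ℂ (σ i).toLinearMap.range)
    {c b : ℝ} (hc0 : 0 ≤ c) (hc : tupleLorentzNorm p σ ≤ ENNReal.ofReal c)
    (hb : 0 ≤ b) (hσb : ∀ x, ‖column σ x‖ ≤ b * ‖x‖) {J : ℕ} (hJ : 1 ≤ J) :
    tupleLorentzNorm p (fun i => ampliation m (σ i)) ≤
      ENNReal.ofReal ((m : ℝ) ^ p⁻¹.toReal * (1 + 1 / (J : ℝ)) * c + J * m * b) := by
  obtain ⟨r, l, e, u, h⟩ := exists_isSVD_column hσ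
  rw [h.tupleLorentzNorm_eq, ENNReal.ofReal_le_ofReal_iff hc0] at hc
  rw [(h.ampliation hm).tupleLorentzNorm_eq, sum_fin_mul]
  refine ENNReal.ofReal_le_ofReal ?_
  have hlb : ∀ j : Fin r, l j ≤ b := fun j => by
    have := hσb (e j)
    rwa [h.norm_apply_left, h.left.1, mul_one] at this
  set q := (m : ℝ) ^ p⁻¹.toReal * (1 + 1 / (J : ℝ)) with hq
  -- Blocks with `j < J` are bounded crudely: `m` weights at most `1`, singular values at most `b`.
  -- Later blocks use the asymptotics of the weights.
  have hterm : ∀ j : Fin r, ∑ a : Fin m, weight p (finProdFinEquiv (j, a) : Fin (r * m)) *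
      l ((finProdFinEquiv (j, a) : Fin (r * m)) / m) ≤
      q * (weight p j * l j) + if (j : ℕ) < J then m * b else 0 := by
    intro j
    have h0 : ∀ a : Fin m, ((finProdFinEquiv (j, a) : Fin (r * m)) : ℕ) / m = j := fun a =>
      congrArg Fin.val (divNat_finProdFinEquiv j a)
    have h1 : ∀ a : Fin m, ((finProdFinEquiv (j, a) : Fin (r * m)) : ℕ) = a + m * j := fun a =>
      rfl
    have hlj := h.nonneg j
    have hwj := weight_pos p j
    simp_rw [h0, h1, ← Finset.sum_mul]
    split_ifs with hjJ
    · have h2 : ∑ a : Fin m, weight p (a + m * j) ≤ m := by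
        calc ∑ a : Fin m, weight p (a + m * j) ≤ ∑ _a : Fin m, (1 : ℝ) :=
              Finset.sum_le_sum fun a _ => weight_le_one hp _
          _ = m := by simp
      have h3 : 0 ≤ q * (weight p j * l j) := by positivity
      calc (∑ a : Fin m, weight p (a + m * j)) * l j ≤ m * b :=
            mul_le_mul h2 (hlb j) hlj (Nat.cast_nonneg m)
        _ ≤ _ := by linarith
    · have h2 : ∑ a : Fin m, weight p (a + m * j) ≤ q * weight p j := by
        calc ∑ a : Fin m, weight p (a + m * j) ≤ ∑ _a : Fin m,
              (m : ℝ) ^ (-1 + p⁻¹.toReal) * ((1 + 1 / (J : ℝ)) * weight p j) :=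
              Finset.sum_le_sum fun a _ => weight_le_of_le hm hp hJ (not_lt.1 hjJ) _
          _ = q * weight p j := by
              rw [Finset.sum_const, Finset.card_univ, Fintype.card_fin, nsmul_eq_mul, hq,
                ← mul_assoc, mul_natCast_rpow_eq hm, mul_assoc]
      rw [add_zero, ← mul_assoc]
      exact mul_le_mul_of_nonneg_right h2 hlj
  have hcount : ∑ j : Fin r, (if (j : ℕ) < J then (m : ℝ) * b else 0) ≤ J * m * b := by
    rw [Fin.sum_univ_eq_sum_range (fun j => if j < J then (m : ℝ) * b else 0), ← Finset.sum_filter,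
      Finset.sum_const, nsmul_eq_mul, mul_assoc]
    refine mul_le_mul_of_nonneg_right ?_ (by positivity)
    have hsub : (Finset.range r).filter (· < J) ⊆ Finset.range J := fun j hj =>
      Finset.mem_range.2 (Finset.mem_filter.1 hj).2
    have := Finset.card_le_card hsub
    rw [Finset.card_range] at this
    exact_mod_cast this
  refine (Finset.sum_le_sum fun j _ => hterm j).trans ?_
  rw [Finset.sum_add_distrib, ← Finset.mul_sum]
  have hq0 : 0 ≤ q := by positivity
  exact add_le_add (mul_le_mul_of_nonneg_left hc hq0) hcount

theorem quasicentralModulus_ampliation_le (hm : 1 ≤ m) {p : ℝ≥0∞} (hp : 1 ≤ p)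
    (τ : Fin n → (H →L[ℂ] H)) :
    quasicentralModulus p (fun i => ampliation m (τ i)) ≤
      (m : ℝ≥0∞) ^ p⁻¹.toReal * quasicentralModulus p τ := by
  have hm' : (0 : ℝ) < m := by exact_mod_cast hm
  rcases eq_or_ne (quasicentralModulus p τ) ∞ with htop | htop
  · rw [htop, natCast_rpow_eq_ofReal hm, ENNReal.mul_top]
    · exact le_top
    · exact (ENNReal.ofReal_pos.2 (by positivity)).ne'
  set k := (quasicentralModulus p τ).toReal with hk
  have hk0 : 0 ≤ k := ENNReal.toReal_nonneg
  set q := (m : ℝ) ^ p⁻¹.toReal with hq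
  -- With `t = 1/(N+1)`, the norm bound is `k + t`, the cutoff is `J = N + 1 = 1/t`, and `b` is
  -- chosen so that `J m b = t`. The resulting estimate is `f t`, which tends to `f 0 = m^{1/p} k`.
  let f : ℝ → ℝ := fun t => q * (1 + t) * (k + t) + t
  have hbound : ∀ N : ℕ, quasicentralModulus p (fun i => ampliation m (τ i)) ≤
      ENNReal.ofReal (f (1 / ((N : ℝ) + 1))) := by
    intro N
    set t : ℝ := 1 / ((N : ℝ) + 1) with ht
    have ht0 : 0 < t := by positivity
    have hlt : quasicentralModulus p τ < ENNReal.ofReal (k + t) := by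
      rw [← ENNReal.ofReal_toReal htop]
      exact (ENNReal.ofReal_lt_ofReal_iff (by positivity)).2 (by linarith)
    set b : ℝ := t / (((N + 1 : ℕ) : ℝ) * m) with hb
    have hb0 : 0 < b := by positivity
    obtain ⟨L, hL⟩ : ∃ L : ℕ, (∑ i, (2 * ‖τ i‖) ^ 2) / 2 ^ L ≤ b ^ 2 := by
      obtain ⟨L, hL⟩ := pow_unbounded_of_one_lt ((∑ i, (2 * ‖τ i‖) ^ 2) / b ^ 2)
        (one_lt_two : (1 : ℝ) < 2)
      refine ⟨L, ?_⟩
      rw [div_le_iff₀ (by positivity)]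
      rw [div_lt_iff₀ (by positivity)] at hL
      linarith
    rw [quasicentralModulus_eq_iSup_iInf]
    refine iSup_le fun B₀ => ?_
    obtain ⟨A₀, hA₀⟩ := exists_le_ampliation B₀
    obtain ⟨A, hA, hAc, hAb⟩ := exists_commutator_small hp hlt L A₀
    refine iInf₂_le_of_le ⟨_, ampliation_mem_finiteRankContractions A.2⟩
      (hA₀.trans (ampliation_mono hA)) ?_
    rw [tupleCommutator_ampliation]
    refine (tupleLorentzNorm_ampliation_le hm hp (finiteDimensional_range_commutator A.2.2.2 τ)
      (by positivity) hAc hb0.le (fun x => ?_) (J := N + 1) (by omega)).trans (le_of_eq ?_)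
    · refine le_of_sq_le_sq ?_ (by positivity)
      rw [mul_pow]
      exact (hAb x).trans (mul_le_mul_of_nonneg_right hL (by positivity))
    · congr 1
      have h1 : ((N + 1 : ℕ) : ℝ) * m * b = t := by
        rw [hb]
        field_simp
      rw [h1, ht]
      push_cast
      rfl
  have hlim : Filter.Tendsto (fun N : ℕ => ENNReal.ofReal (f (1 / ((N : ℝ) + 1)))) Filter.atTop
      (nhds (ENNReal.ofReal (f 0))) := by
    have hf : Continuous f := by fun_prop
    exact ENNReal.tendsto_ofReal ((hf.tendsto 0).comp tendsto_one_div_add_atTop_nhds_zero_nat)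
  have hle := ge_of_tendsto' hlim hbound
  have hf0 : f 0 = q * k := by simp [f]
  rwa [hf0, ENNReal.ofReal_mul (by positivity), ← natCast_rpow_eq_ofReal hm,
    ENNReal.ofReal_toReal htop] at hle

end Formula

end QuasicentralModulus

theorem theorem6p3 {H : Type*} [NormedAddCommGroup H] [InnerProductSpace ℂ H] [CompleteSpace H]
    [TopologicalSpace.SeparableSpace H] (hH : ¬ FiniteDimensional ℂ H)
    (n : ℕ) (τ : Fin n → (H →L[ℂ] H)) (m : ℕ) (hm : 1 ≤ m) (p : ℝ≥0∞) (hp : 1 ≤ p) :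
    QuasicentralModulus.quasicentralModulus p
        (fun i => QuasicentralModulus.ampliation m (τ i)) =
      (m : ℝ≥0∞) ^ p⁻¹.toReal * QuasicentralModulus.quasicentralModulus p τ :=
  le_antisymm (QuasicentralModulus.quasicentralModulus_ampliation_le hm hp τ)
    (QuasicentralModulus.rpow_mul_quasicentralModulus_le hm hp τ)
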